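/- Let $q_1,q_2\ge 1$ be integers and let $\chi_1,\chi_2$ be primitive Dirichlet characters modulo $q_1,q_2$, respectively, with $\chi_1\chi_2(-1)=1$ (if $q_i=1$, then $\chi_i(n)=1$ for all $n\in\mathbb Z$). Put $\psi=\chi_1\overline{\chi_2}$, $e(x)=e^{2\pi i x}$ and $\tau(\chi)=\sum_{a \bmod q}\chi(a)e(a/q)$ for a character $\chi$ modulo $q$. For $z$ in the upper half plane $\mathbb H$ let $$F_{\chi_1,\chi_2}(z)=c_1z+c_0+\sum_{n=1}^{\infty}\frac{\lambda_{\chi_1,\chi_2}(n,1)}{\sqrt n}\,e(nz),\qquad \lambda_{\chi_1,\chi_2}(n,1)=\sum_{ab=n}\chi_1(a)\overline{\chi_2}(b)\,(b/a)^{1/2},$$ where $c_1=\pi i\,L(-1,\overline{\chi_2})$ if $q_1=1$ and $c_1=0$ otherwise, and $c_0=\tfrac12L(1,\chi_1)$ if $q_2=1$ and $c_0=0$ otherwise. For $\gamma=\begin{pmatrix}a&b\\c&d\end{pmatrix}\in\Gamma_0(q_1q_2)$ write $\psi(\gamma)=\psi(d)$. If the function $$z\mapsto \frac{\tau(\overline{\chi_1})}{\pi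 i}\bigl(F_{\chi_1,\chi_2}(\gamma z)-\psi(\gamma)F_{\chi_1,\chi_2}(z)\bigr)$$ is constant on $\mathbb H$, its value is the newform Dedekind sum $S_{\chi_1,\chi_2}(\gamma)$. For integers $a,c$, the equation $S_{\chi_1,\chi_2}(a,c)=s$ means that $(a,c)$ is the left column of some matrix in $\Gamma_0(q_1q_2)$ and that, for every $\gamma\in\Gamma_0(q_1q_2)$ with left column $(a,c)$, this function is constant and $S_{\chi_1,\chi_2}(\gamma)=s$. **Theorem.** Let $N=q_1q_2=QR$ with positive integers $Q,R$ such that $(Q,R)=1$, and suppose that $q_1\ne 1$ and $q_2\neq R$. Let $r,u\in\mathbb Z$ with $(r,R)=1$ and $(u,Q)=1$. Then for every $k\in\mathbb Z$ and each choice of the sign, $$S_{\chi_1,\chi_2}(\pm1+Nkur,\;NRku^2)=0.$$ -/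

import Mathlib

open scoped BigOperators MatrixGroups UpperHalfPlane

noncomputable section

namespace NewformDedekind

variable {q₁ q₂ : ℕ} [NeZero q₁] [NeZero q₂]

/-- The Gauss sum `τ(χ) = ∑_{a mod q} χ(a) e(a/q)`, where `e(x) = exp(2πix)`. -/
def tau {q : ℕ} [NeZero q] (χ : DirichletCharacter ℂ q) : ℂ :=
  gaussSum χ (ZMod.stdAddChar (N := q))

/-- The coefficient `λ(n, 1) = ∑_{ab = n} χ₁(a) χ̄₂(b) (b/a)^{1/2}` for `n ≥ 1`.
The conjugate `χ̄₂` of a Dirichlet character is its inverse `χ₂⁻¹`. -/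
def lam (χ₁ : DirichletCharacter ℂ q₁) (χ₂ : DirichletCharacter ℂ q₂) (n : ℕ) : ℂ :=
  ∑ p ∈ n.divisorsAntidiagonal,
    χ₁ (p.1 : ZMod q₁) * χ₂⁻¹ (p.2 : ZMod q₂) * (Real.sqrt ((p.2 : ℝ) / (p.1 : ℝ)) : ℂ)

/-- The linear coefficient: `πi L(-1, χ̄₂)` if `q₁ = 1`, and `0` otherwise. -/
def cOne (_χ₁ : DirichletCharacter ℂ q₁) (χ₂ : DirichletCharacter ℂ q₂) : ℂ :=
  if q₁ = 1 then (Real.pi : ℂ) * Complex.I * DirichletCharacter.LFunction χ₂⁻¹ (-1) else 0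

/-- The constant coefficient: `L(1, χ₁) / 2` if `q₂ = 1`, and `0` otherwise. -/
def cZero (χ₁ : DirichletCharacter ℂ q₁) (_χ₂ : DirichletCharacter ℂ q₂) : ℂ :=
  if q₂ = 1 then (1 / 2 : ℂ) * DirichletCharacter.LFunction χ₁ 1 else 0

/-- The holomorphic function
`F(z) = c₁ z + c₀ + ∑_{n ≥ 1} λ(n, 1) n^{-1/2} e(nz)` on the upper half plane
(the series converges absolutely). -/
def F (χ₁ : DirichletCharacter ℂ q₁) (χ₂ : DirichletCharacter ℂ q₂) (z : ℍ) : ℂ :=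
  cOne χ₁ χ₂ * (z : ℂ) + cZero χ₁ χ₂ +
    ∑' n : ℕ+, lam χ₁ χ₂ (n : ℕ) / (Real.sqrt ((n : ℕ) : ℝ) : ℂ) *
      Complex.exp (2 * (Real.pi : ℂ) * Complex.I * ((n : ℕ) : ℂ) * (z : ℂ))

/-- The value `ψ(γ) = ψ(d)` of `ψ = χ₁ χ̄₂` at the lower right entry `d` of `γ`. -/
def psi (χ₁ : DirichletCharacter ℂ q₁) (χ₂ : DirichletCharacter ℂ q₂) (γ : SL(2, ℤ)) : ℂ :=
  χ₁ ((γ 1 1 : ℤ) : ZMod q₁) * χ₂⁻¹ ((γ 1 1 : ℤ) : ZMod q₂)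

/-- The function `φ(γ, z) = F(γz) - ψ(γ) F(z)`. -/
def phi (χ₁ : DirichletCharacter ℂ q₁) (χ₂ : DirichletCharacter ℂ q₂)
    (γ : SL(2, ℤ)) (z : ℍ) : ℂ :=
  F χ₁ χ₂ (γ • z) - psi χ₁ χ₂ γ * F χ₁ χ₂ z

/-- `S(γ) = s`: the function `z ↦ τ(χ̄₁) / (πi) · φ(γ, z)` on the upper half plane is constant,
and `s` is its value. At most one `s` has this property. -/
def HasDedekindSum (χ₁ : DirichletCharacter ℂ q₁) (χ₂ : DirichletCharacter ℂ q₂)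
    (γ : SL(2, ℤ)) (s : ℂ) : Prop :=
  ∀ z : ℍ, tau χ₁⁻¹ / ((Real.pi : ℂ) * Complex.I) * phi χ₁ χ₂ γ z = s

/-- `S(a, c) = s`: the pair `(a, c)` is the left column of some matrix in `Γ₀(q₁q₂)`, and
`S(γ) = s` for every `γ ∈ Γ₀(q₁q₂)` with that left column. -/
def HasDedekindSumAt (χ₁ : DirichletCharacter ℂ q₁) (χ₂ : DirichletCharacter ℂ q₂)
    (a c : ℤ) (s : ℂ) : Prop :=
  (∃ γ ∈ CongruenceSubgroup.Gamma0 (q₁ * q₂), γ 0 0 = a ∧ γ 1 0 = c) ∧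
    ∀ γ ∈ CongruenceSubgroup.Gamma0 (q₁ * q₂), γ 0 0 = a → γ 1 0 = c →
      HasDedekindSum χ₁ χ₂ γ s

end NewformDedekind

end

noncomputable section

namespace NewformDedekind

open Filter Topology Complex

/-! Since q₁ ≠ 1, F is a constant plus the double series `eisSeries`, whose derivative is a weight
two Eisenstein series. Gauss sums and the Lipschitz formula turn this derivative, with τ = q₁z, into
a multiple of ∑ χ₁(i)χ₂(j) ℘(iτ/q₁ + j/q₂) for the lattice ℤτ + ℤ (`exists_hasDerivAt_eisSeries`).
The coefficients sum to 0, so only differences of lattice sums matter, and SL₂(ℤ) merely moves the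
torsion points (`torsionSum_modular`).

Up to sign and a translation z ↦ z + n, a matrix with the given left column is parabolic and fixes
the cusp r/(Ru). Coprimality and q₂ ≠ R keep every relevant torsion point off the integral rows at
this cusp (`cusp_ne_int`), so the derivative vanishes there. The primitive changes by a constant
under the parabolic matrix; with the cusp moved to ∞ this constant is an increment over an integer
translation, and the decay of the derivative forces it to be 0 (`comp_parabolic_eq`). Parity gives
ψ(γ) = 1, hence φ = 0. -/

/-! ### One row of the lattice sum and its exponential decay. -/

/-- The series `∑_{n ∈ ℤ} (w + n)⁻²`, equal to `π² / sin² (π w)` off the integers. -/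
def invSqSum (w : ℂ) : ℂ := ∑' n : ℤ, 1 / (w + n) ^ 2

theorem summable_invSq (w : ℂ) : Summable fun n : ℤ => 1 / (w + n) ^ 2 := by
  have h := EisensteinSeries.linear_right_summable w 1 (k := 2) le_rfl
  refine h.congr fun n => ?_
  rw [one_div]
  norm_cast
  simp

theorem invSqSum_neg (w : ℂ) : invSqSum (-w) = invSqSum w := by
  unfold invSqSum
  rw [← (Equiv.neg ℤ).tsum_eq]
  refine tsum_congr fun n => ?_
  simp only [Equiv.neg_apply, Int.cast_neg]
  rw [← neg_add, neg_sq]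

theorem invSqSum_add_int (w : ℂ) (k : ℤ) : invSqSum (w + k) = invSqSum w := by
  unfold invSqSum
  rw [← (Equiv.addLeft k).tsum_eq (fun n : ℤ => 1 / (w + n) ^ 2)]
  refine tsum_congr fun n => ?_
  simp [add_assoc]

theorem invSqSum_eq_tsum_exp {w : ℂ} (hw : 0 < w.im) :
    invSqSum w = -4 * Real.pi ^ 2 *
      ∑' b : ℕ+, ((b : ℕ) : ℂ) * exp (2 * Real.pi * I * (b : ℕ) * w) := by
  have h := EisensteinSeries.qExpansion_identity_pnat (k := 1) le_rfl ⟨w, hw⟩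
  simp only [one_add_one_eq_two] at h
  unfold invSqSum
  rw [h]
  congr 1
  · simp only [Nat.factorial_one, Nat.cast_one, div_one]
    rw [mul_pow, I_sq]; ring
  · refine tsum_congr fun b => ?_
    rw [pow_one, ← exp_nat_mul]
    congr 2; ring

theorem summable_nat_mul_exp {c : ℝ} (hc : 0 < c) :
    Summable fun b : ℕ+ => (b : ℝ) * Real.exp (-c * (b : ℝ)) := by
  have h := (Real.summable_pow_mul_exp_neg_nat_mul 1 hc)
  have h2 := h.comp_injective PNat.coe_injective
  refine h2.congr fun b => ?_
  simp

/-- The exponential expansion starts at b = 1, and b·Im w ≥ (b - 1) + Im w for b, Im w ≥ 1; this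
extracts the factor exp(-2π Im w). -/
theorem norm_invSqSum_le_of_pos :
    ∃ K : ℝ, ∀ {w : ℂ}, 1 ≤ w.im → ‖invSqSum w‖ ≤ K * Real.exp (-(2 * Real.pi) * w.im) := by
  have hpi := Real.pi_pos
  have hs : Summable fun b : ℕ+ => (b : ℝ) * Real.exp (-(2 * Real.pi) * ((b : ℝ) - 1)) := by
    refine ((summable_nat_mul_exp (c := 2 * Real.pi) (by positivity)).mul_left
      (Real.exp (2 * Real.pi))).congr fun b => ?_
    rw [mul_left_comm, ← Real.exp_add]
    congr 2; ring
  refine ⟨4 * Real.pi ^ 2 * ∑' b : ℕ+, (b : ℝ) * Real.exp (-(2 * Real.pi) * ((b : ℝ) - 1)),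
    fun {w} hw => ?_⟩
  rw [invSqSum_eq_tsum_exp (by linarith), norm_mul]
  have h1 : ‖(-4 * Real.pi ^ 2 : ℂ)‖ = 4 * Real.pi ^ 2 := by
    rw [norm_mul, norm_pow, norm_neg, Complex.norm_real, Real.norm_of_nonneg hpi.le]
    norm_num
  rw [h1, mul_assoc (4 * Real.pi ^ 2)]
  refine mul_le_mul_of_nonneg_left ?_ (by positivity)
  rw [← tsum_mul_right]
  refine tsum_of_norm_bounded (hs.mul_right _).hasSum fun b => ?_
  rw [norm_mul, Complex.norm_natCast, Complex.norm_exp, mul_assoc ((b : ℕ) : ℝ), ← Real.exp_add]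
  gcongr
  have hb : (1 : ℝ) ≤ (b : ℕ) := Nat.one_le_cast.2 b.pos
  have : (2 * Real.pi * I * (b : ℕ) * w).re = -(2 * Real.pi) * ((b : ℕ) * w.im) := by
    have : (2 * Real.pi * I * (b : ℕ) * w : ℂ) = ((2 * Real.pi * (b : ℕ) : ℝ) : ℂ) * (I * w) := by
      push_cast; ring
    rw [this, Complex.re_ofReal_mul]
    simp; ring
  rw [this]
  nlinarith [mul_nonneg hpi.le (mul_nonneg (sub_nonneg.2 hb) (sub_nonneg.2 hw))]

theorem norm_invSqSum_le :
    ∃ K : ℝ, ∀ {w : ℂ}, 1 ≤ |w.im| → ‖invSqSum w‖ ≤ K * Real.exp (-(2 * Real.pi) * |w.im|) := by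
  obtain ⟨K, hK⟩ := norm_invSqSum_le_of_pos
  refine ⟨K, fun {w} hw => ?_⟩
  rcases le_total 0 w.im with h | h
  · rw [abs_of_nonneg h] at hw ⊢
    exact hK hw
  · rw [abs_of_nonpos h] at hw ⊢
    have := hK (w := -w) (by simpa using hw)
    rwa [invSqSum_neg, neg_im] at this

/-! ### Summation over the rows. -/

theorem abs_mul_of_pos {a : ℝ} (ha : 0 < a) (b : ℝ) : |a * b| = a * |b| := by
  rw [abs_mul, abs_of_pos ha]

theorem summable_exp_neg_mul_abs_int {c : ℝ} (hc : 0 < c) :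
    Summable fun m : ℤ => Real.exp (-c * |(m : ℝ)|) := by
  have h : Summable fun m : ℕ => Real.exp (-c * m) := by
    have := Real.summable_pow_mul_exp_neg_nat_mul 0 hc
    simpa using this
  refine Summable.of_nat_of_neg ?_ ?_ <;> simpa using h

theorem summable_exp_neg_mul_abs_add_int {c : ℝ} (hc : 0 < c) (x : ℝ) :
    Summable fun m : ℤ => Real.exp (-c * |x + m|) := by
  refine Summable.of_nonneg_of_le (fun _ => (Real.exp_pos _).le) (fun m => ?_)
    ((summable_exp_neg_mul_abs_int hc).mul_left (Real.exp (c * |x|)))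
  rw [← Real.exp_add]
  gcongr
  have : |(m : ℝ)| ≤ |x + m| + |x| := by
    have := abs_sub (x + m) x
    rwa [add_sub_cancel_left] at this
  nlinarith

theorem tendsto_abs_add_int (x : ℝ) : Tendsto (fun m : ℤ => |x + m|) cofinite atTop := by
  have h : Tendsto (fun m : ℤ => |(m : ℝ)| - |x|) cofinite atTop := by
    apply tendsto_atTop_add_const_right
    rw [Int.cofinite_eq]
    refine Tendsto.sup ?_ ?_
    · exact tendsto_abs_atBot_atTop.comp (tendsto_intCast_atBot_iff.2 tendsto_id)
    · exact tendsto_abs_atTop_atTop.comp tendsto_intCast_atTop_atTop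
  refine tendsto_atTop_mono (fun m => ?_) h
  have := abs_sub (x + m) x
  rw [add_sub_cancel_left] at this
  linarith

/-- All but finitely many rows lie at height at least 1 in absolute value, where the exponential
bound applies. -/
theorem summable_invSqSum {τ : ℂ} (hτ : 0 < τ.im) (w : ℂ) :
    Summable fun m : ℤ => invSqSum (w + m * τ) := by
  obtain ⟨K, hK⟩ := norm_invSqSum_le
  have him (m : ℤ) : |(w + m * τ).im| = τ.im * |w.im / τ.im + m| := by
    rw [← abs_mul_of_pos hτ]
    congr 1
    simp; field_simp
  have h := (summable_exp_neg_mul_abs_add_int (c := 2 * Real.pi * τ.im)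
    (by have := Real.pi_pos; positivity) (w.im / τ.im)).mul_left K
  refine h.of_norm_bounded_eventually ?_
  filter_upwards [(tendsto_abs_add_int (w.im / τ.im)).eventually_ge_atTop (1 / τ.im)] with m hm
  have := hK (w := w + m * τ) (by rw [him]; rwa [div_le_iff₀' hτ] at hm)
  rw [him] at this
  refine this.trans (le_of_eq ?_)
  congr 2; ring

/-! ### Lattice sums and their modularity. -/

/-- The iterated sum `∑_m ∑_n (w + mτ + n)⁻²`. -/
def eisSum (τ w : ℂ) : ℂ := ∑' m : ℤ, invSqSum (w + m * τ)

theorem eisSum_add_int (τ w : ℂ) (k : ℤ) : eisSum τ (w + k) = eisSum τ w := by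
  unfold eisSum
  refine tsum_congr fun m => ?_
  rw [add_right_comm, invSqSum_add_int]

theorem eisSum_add_int_mul (τ w : ℂ) (k : ℤ) : eisSum τ (w + k * τ) = eisSum τ w := by
  unfold eisSum
  rw [← (Equiv.addLeft k).tsum_eq (fun m : ℤ => invSqSum (w + m * τ))]
  refine tsum_congr fun m => ?_
  congr 1
  simp; ring

/-- The Weierstrass function of the lattice `ℤ τ + ℤ`, as a sum over `ℤ × ℤ`. -/
def weierSum (τ w : ℂ) : ℂ :=
  ∑' p : ℤ × ℤ, (1 / (w + (p.1 * τ + p.2)) ^ 2 - 1 / (p.1 * τ + p.2) ^ 2)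

/-- At p = (0, 0) the subtracted term is 1/0 = 0, so this is the usual ℘ series; evenness allows
evaluation at -w. -/
theorem summable_weierSum {τ : ℂ} (hτ : 0 < τ.im) (w : ℂ) :
    Summable fun p : ℤ × ℤ =>
      (1 / (w + (p.1 * τ + p.2)) ^ 2 - 1 / (p.1 * τ + p.2) ^ 2 : ℂ) := by
  let L : PeriodPair :=
    { ω₁ := τ
      ω₂ := 1
      indep := by
        rw [LinearIndependent.pair_iff]
        intro s t h
        have h1 := congrArg Complex.im h
        have h2 := congrArg Complex.re h
        simp only [real_smul, mul_one, add_im, im_ofReal_mul, ofReal_im, add_zero, zero_im,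
          mul_eq_zero, hτ.ne', or_false] at h1
        subst h1
        simpa using h2 }
  have h := (L.hasSum_weierstrassP (-w)).summable
  have h2 := L.latticeEquivProd.symm.toEquiv.summable_iff.2 h
  refine h2.congr fun p => ?_
  simp only [Function.comp, LinearEquiv.coe_toEquiv, PeriodPair.latticeEquiv_symm_apply, L, mul_one]
  rw [← neg_add', neg_sq]

theorem weierSum_eq {τ : ℂ} (hτ : 0 < τ.im) (w : ℂ) :
    weierSum τ w = eisSum τ w - eisSum τ 0 := by
  have h0 := summable_invSqSum hτ 0
  unfold weierSum eisSum
  rw [(summable_weierSum hτ w).tsum_prod, ← (summable_invSqSum hτ w).tsum_sub h0]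
  refine tsum_congr fun m => ?_
  have h1 := summable_invSq (w + m * τ)
  have h2 := summable_invSq (0 + m * τ)
  unfold invSqSum
  rw [← h1.tsum_sub h2]
  refine tsum_congr fun n => ?_
  simp [add_assoc]

/-- Row vectors (m, n) are permuted by right multiplication by the matrix, and the terms are
homogeneous of degree -2. The iterated sum `eisSum` admits no such rearrangement. -/
theorem weierSum_modular {a b c d : ℤ} (h : a * d - b * c = 1) (τ w : ℂ)
    (hJ : (c * τ + d : ℂ) ≠ 0) :
    weierSum ((a * τ + b) / (c * τ + d)) (w / (c * τ + d)) = (c * τ + d) ^ 2 * weierSum τ w := by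
  let e : ℤ × ℤ ≃ ℤ × ℤ :=
    { toFun := fun p => (p.1 * a + p.2 * c, p.1 * b + p.2 * d)
      invFun := fun p => (p.1 * d - p.2 * c, -p.1 * b + p.2 * a)
      left_inv := fun p => by
        ext
        · simp only; linear_combination p.1 * h
        · simp only; linear_combination p.2 * h
      right_inv := fun p => by
        ext
        · simp only; linear_combination p.1 * h
        · simp only; linear_combination p.2 * h }
  unfold weierSum
  rw [← e.tsum_eq (fun p : ℤ × ℤ =>
    (1 / (w + (p.1 * τ + p.2)) ^ 2 - 1 / (p.1 * τ + p.2) ^ 2 : ℂ)), ← tsum_mul_left]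
  refine tsum_congr fun p => ?_
  have h1 : (p.1 * ((a * τ + b) / (c * τ + d)) + p.2 : ℂ) =
      (((e p).1 : ℤ) * τ + ((e p).2 : ℤ)) / (c * τ + d) := by
    simp only [e, Equiv.coe_fn_mk]
    push_cast
    rw [eq_div_iff hJ, add_mul, mul_assoc, div_mul_cancel₀ _ hJ]
    ring
  rw [h1, ← add_div, div_pow, div_pow, one_div_div, one_div_div, mul_sub]
  ring

/-- A finite combination of torsion values of `eisSum τ`. -/
def torsionSum {ι : Type*} [Fintype ι] (c : ι → ℂ) (x y : ι → ℝ) (τ : ℂ) : ℂ :=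
  ∑ i, c i * eisSum τ (x i * τ + y i)

/-- Coefficients of total 0 cancel `eisSum τ 0`, the obstruction to modularity. -/
theorem torsionSum_eq_weierSum {ι : Type*} [Fintype ι] {c : ι → ℂ} (hc : ∑ i, c i = 0)
    (x y : ι → ℝ) {τ : ℂ} (hτ : 0 < τ.im) :
    torsionSum c x y τ = ∑ i, c i * weierSum τ (x i * τ + y i) := by
  simp only [weierSum_eq hτ, mul_sub, Finset.sum_sub_distrib, ← Finset.sum_mul, hc, zero_mul,
    sub_zero, torsionSum]

theorem im_moebius_pos {a b c d : ℤ} (h : a * d - b * c = 1) {τ : ℂ} (hτ : 0 < τ.im) :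
    0 < ((a * τ + b) / (c * τ + d)).im := by
  let g : SL(2, ℤ) := ⟨!![a, b; c, d], by rw [Matrix.det_fin_two_of, h]⟩
  have := (g • (⟨τ, hτ⟩ : ℍ)).im_pos
  rw [← UpperHalfPlane.coe_im, UpperHalfPlane.specialLinearGroup_apply] at this
  simpa [g] using this

theorem denom_ne_zero_of_det {a b c d : ℤ} (h : a * d - b * c = 1) {τ : ℂ} (hτ : 0 < τ.im) :
    (c * τ + d : ℂ) ≠ 0 := by
  intro h0
  have := im_moebius_pos h hτ
  simp [h0] at this

theorem torsionSum_modular {ι : Type*} [Fintype ι] {k : ι → ℂ} (hk : ∑ i, k i = 0)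
    (x y : ι → ℝ) {a b c d : ℤ} (h : a * d - b * c = 1) {τ : ℂ} (hτ : 0 < τ.im) :
    torsionSum k x y ((a * τ + b) / (c * τ + d)) = (c * τ + d) ^ 2 *
      torsionSum k (fun i => x i * a + y i * c) (fun i => x i * b + y i * d) τ := by
  have hJ := denom_ne_zero_of_det h hτ
  rw [torsionSum_eq_weierSum hk _ _ hτ, torsionSum_eq_weierSum hk _ _ (im_moebius_pos h hτ),
    Finset.mul_sum]
  refine Finset.sum_congr rfl fun i _ => ?_
  rw [mul_left_comm, ← weierSum_modular h _ _ hJ]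
  congr 2
  push_cast
  rw [eq_div_iff hJ, add_mul, mul_assoc, div_mul_cancel₀ _ hJ]
  ring

theorem torsionSum_congr_int {ι : Type*} [Fintype ι] {c : ι → ℂ} {x y x' y' : ι → ℝ}
    (h : ∀ i, c i ≠ 0 → (∃ m : ℤ, x i = x' i + m) ∧ ∃ n : ℤ, y i = y' i + n) (τ : ℂ) :
    torsionSum c x y τ = torsionSum c x' y' τ := by
  refine Finset.sum_congr rfl fun i _ => ?_
  by_cases hi : c i = 0
  · simp [hi]
  obtain ⟨⟨m, hm⟩, n, hn⟩ := h i hi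
  rw [hm, hn, ← eisSum_add_int_mul τ (x' i * τ + y' i) m,
    ← eisSum_add_int τ (x' i * τ + y' i + m * τ) n]
  congr 2
  push_cast; ring

/-! ### Vanishing at the cusp ∞. -/

/-- For x not an integer no row stays at bounded height: row m has height Im τ·|x + m| in absolute
value, and |x + m| is bounded below. Dominated convergence applies. -/
theorem tendsto_eisSum {x : ℝ} (hx : ∀ m : ℤ, x ≠ m) (y : ℝ) :
    Tendsto (fun τ : ℂ => eisSum τ (x * τ + y)) (comap im atTop) (𝓝 0) := by
  obtain ⟨K, hK⟩ := norm_invSqSum_le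
  have hx' (m : ℤ) : x + m ≠ 0 := fun h => hx (-m) (by push_cast; linarith)
  have hpi := Real.pi_pos
  have hlow : ∃ δ > 0, ∀ m : ℤ, δ ≤ |x + m| := by
    obtain ⟨m₀, hm₀⟩ := (tendsto_abs_add_int x).exists_forall_le
    exact ⟨|x + m₀|, abs_pos.2 (hx' m₀), hm₀⟩
  obtain ⟨δ, hδ, hlow⟩ := hlow
  have him (m : ℤ) {τ : ℂ} (hτ : 0 < τ.im) : |(x * τ + y + m * τ).im| = τ.im * |x + m| := by
    rw [← abs_mul_of_pos hτ]
    congr 1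
    simp; ring
  have hbd : ∀ᶠ τ in comap im atTop, ∀ m : ℤ, ‖invSqSum (x * τ + y + m * τ)‖ ≤
      K * Real.exp (-(2 * Real.pi) * (τ.im * |x + m|)) := by
    have : ∀ᶠ τ : ℂ in comap im atTop, 1 / δ ≤ τ.im := tendsto_comap.eventually_ge_atTop _
    filter_upwards [this] with τ hτ m
    have hpos : 0 < τ.im := lt_of_lt_of_le (by positivity) hτ
    rw [div_le_iff₀ hδ] at hτ
    rw [← him m hpos]
    refine hK ?_
    rw [him m hpos]
    exact hτ.trans (by gcongr; exact hlow m)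
  have key := tendsto_tsum_of_dominated_convergence (𝓕 := comap im atTop)
    (f := fun (τ : ℂ) (m : ℤ) => invSqSum (x * τ + y + m * τ)) (g := fun _ => 0)
    ((summable_exp_neg_mul_abs_add_int (c := 2 * Real.pi) (by positivity) x).mul_left |K|) ?_ ?_
  · simpa [eisSum] using key
  · intro m
    have : Tendsto (fun τ : ℂ => K * Real.exp (-(2 * Real.pi) * (τ.im * |x + m|)))
        (comap im atTop) (𝓝 0) := by
      rw [← mul_zero K]
      refine Tendsto.const_mul _ (Real.tendsto_exp_atBot.comp ?_)
      refine Tendsto.const_mul_atTop_of_neg (by linarith) ?_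
      exact tendsto_comap.atTop_mul_const (abs_pos.2 (hx' m))
    exact squeeze_zero_norm' (hbd.mono fun τ h => h m) this
  · filter_upwards [hbd, tendsto_comap.eventually_ge_atTop (1 : ℝ)] with τ hτ h1 m
    refine (hτ m).trans ?_
    have h2 : K ≤ |K| := le_abs_self K
    gcongr ?_ * Real.exp ?_
    have := abs_nonneg (x + m)
    nlinarith [mul_nonneg hpi.le (mul_nonneg this (sub_nonneg.2 h1))]

theorem tendsto_torsionSum {ι : Type*} [Fintype ι] {c : ι → ℂ} {x : ι → ℝ} (y : ι → ℝ)
    (hx : ∀ i, c i ≠ 0 → ∀ m : ℤ, x i ≠ m) :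
    Tendsto (torsionSum c x y) (comap im atTop) (𝓝 0) := by
  unfold torsionSum
  rw [← Finset.sum_const_zero (s := (Finset.univ : Finset ι))]
  refine tendsto_finsetSum _ fun i _ => ?_
  by_cases hi : c i = 0
  · simpa [hi] using tendsto_const_nhds
  · simpa using (tendsto_eisSum (hx i hi) (y i)).const_mul (c i)

/-! ### The Eisenstein series and its derivative. -/

section

variable {q₁ q₂ : ℕ}

/-- The term of index `(a, b)` in the double series of the Eisenstein series of weight zero. -/
def eisTerm (χ₁ : DirichletCharacter ℂ q₁) (χ₂ : DirichletCharacter ℂ q₂) (p : ℕ+ × ℕ+) (z : ℂ) :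
    ℂ :=
  χ₁ ((p.1 : ℕ) : ZMod q₁) * χ₂⁻¹ ((p.2 : ℕ) : ZMod q₂) / (p.1 : ℕ) *
    exp (2 * Real.pi * I * ((p.1 : ℕ) * (p.2 : ℕ)) * z)

/-- The double series `∑_{a, b ≥ 1} χ₁(a) χ̄₂(b) a⁻¹ e(abz)`. -/
def eisSeries (χ₁ : DirichletCharacter ℂ q₁) (χ₂ : DirichletCharacter ℂ q₂) (z : ℂ) : ℂ :=
  ∑' p : ℕ+ × ℕ+, eisTerm χ₁ χ₂ p z

theorem norm_exp_two_pi_mul_I (n : ℕ) (z : ℂ) :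
    ‖exp (2 * Real.pi * I * n * z)‖ = Real.exp (-(2 * Real.pi) * z.im) ^ n := by
  rw [Complex.norm_exp, ← Real.exp_nat_mul]
  congr 1
  have : (2 * Real.pi * I * n * z : ℂ) = ((2 * Real.pi * n : ℝ) : ℂ) * (I * z) := by
    push_cast; ring
  rw [this, Complex.re_ofReal_mul]
  simp; ring

theorem norm_eisTerm_le (χ₁ : DirichletCharacter ℂ q₁) (χ₂ : DirichletCharacter ℂ q₂)
    (p : ℕ+ × ℕ+) {δ : ℝ} {z : ℂ} (hz : δ ≤ z.im) :
    ‖eisTerm χ₁ χ₂ p z‖ ≤ Real.exp (-(2 * Real.pi) * δ) ^ ((p.1 : ℕ) * (p.2 : ℕ)) := by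
  have hpi := Real.pi_pos
  have h := norm_exp_two_pi_mul_I ((p.1 : ℕ) * (p.2 : ℕ)) z
  push_cast at h
  unfold eisTerm
  rw [norm_mul, h, norm_div, norm_mul, Complex.norm_natCast]
  have h1 := DirichletCharacter.norm_le_one χ₁ ((p.1 : ℕ) : ZMod q₁)
  have h2 := DirichletCharacter.norm_le_one χ₂⁻¹ ((p.2 : ℕ) : ZMod q₂)
  have h3 : (1 : ℝ) ≤ ((p.1 : ℕ) : ℝ) := Nat.one_le_cast.2 p.1.pos
  have h4 : ‖χ₁ ((p.1 : ℕ) : ZMod q₁)‖ * ‖χ₂⁻¹ ((p.2 : ℕ) : ZMod q₂)‖ / ((p.1 : ℕ) : ℝ) ≤ 1 :=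
    div_le_one_of_le₀ ((mul_le_one₀ h1 (norm_nonneg _) h2).trans h3) (by positivity)
  refine (mul_le_of_le_one_left (by positivity) h4).trans ?_
  refine pow_le_pow_left₀ (Real.exp_pos _).le (Real.exp_le_exp.2 ?_) _
  nlinarith

theorem summable_exp_pow_mul {δ : ℝ} (hδ : 0 < δ) :
    Summable fun p : ℕ+ × ℕ+ => Real.exp (-(2 * Real.pi) * δ) ^ ((p.1 : ℕ) * (p.2 : ℕ)) := by
  have h := summable_prod_mul_pow (𝕜 := ℝ) 0 (r := Real.exp (-(2 * Real.pi) * δ)) (by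
    have := Real.pi_pos
    rw [Real.norm_of_nonneg (Real.exp_pos _).le, Real.exp_lt_one_iff]
    nlinarith [mul_pos this hδ])
  simpa using h

theorem summable_eisTerm (χ₁ : DirichletCharacter ℂ q₁) (χ₂ : DirichletCharacter ℂ q₂)
    {z : ℂ} (hz : 0 < z.im) : Summable fun p => eisTerm χ₁ χ₂ p z :=
  (summable_exp_pow_mul hz).of_norm_bounded fun p => norm_eisTerm_le χ₁ χ₂ p le_rfl

theorem hasDerivAt_eisTerm (χ₁ : DirichletCharacter ℂ q₁) (χ₂ : DirichletCharacter ℂ q₂)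
    (p : ℕ+ × ℕ+) (z : ℂ) :
    HasDerivAt (eisTerm χ₁ χ₂ p) (2 * Real.pi * I * (χ₁ ((p.1 : ℕ) : ZMod q₁) *
      (χ₂⁻¹ ((p.2 : ℕ) : ZMod q₂) * ((p.2 : ℕ) *
        exp (2 * Real.pi * I * (p.2 : ℕ) * ((p.1 : ℕ) * z)))))) z := by
  have h := (((hasDerivAt_id z).const_mul (2 * Real.pi * I * ((p.1 : ℕ) * (p.2 : ℕ)))).cexp).const_mul
    (χ₁ ((p.1 : ℕ) : ZMod q₁) * χ₂⁻¹ ((p.2 : ℕ) : ZMod q₂) / (p.1 : ℕ))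
  refine h.congr_deriv ?_
  have hp : ((p.1 : ℕ) : ℂ) ≠ 0 := by exact_mod_cast p.1.ne_zero
  simp only [id]
  rw [show (2 * Real.pi * I * (p.2 : ℕ) * ((p.1 : ℕ) * z) : ℂ) =
    2 * Real.pi * I * ((p.1 : ℕ) * (p.2 : ℕ)) * z by ring]
  field_simp

theorem hasDerivAt_eisSeries (χ₁ : DirichletCharacter ℂ q₁) (χ₂ : DirichletCharacter ℂ q₂)
    {z : ℂ} (hz : 0 < z.im) :
    HasDerivAt (eisSeries χ₁ χ₂) (2 * Real.pi * I * ∑' a : ℕ+, χ₁ ((a : ℕ) : ZMod q₁) *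
      ∑' b : ℕ+, χ₂⁻¹ ((b : ℕ) : ZMod q₂) * ((b : ℕ) *
        exp (2 * Real.pi * I * (b : ℕ) * ((a : ℕ) * z)))) z := by
  have hU : IsOpen {w : ℂ | z.im / 2 < w.im} := isOpen_lt continuous_const continuous_im
  have hzU : z ∈ {w : ℂ | z.im / 2 < w.im} := by simp only [Set.mem_ofPred_eq]; linarith
  have hsum := summable_exp_pow_mul (half_pos hz)
  have hdiff (p : ℕ+ × ℕ+) : DifferentiableOn ℂ (eisTerm χ₁ χ₂ p) {w : ℂ | z.im / 2 < w.im} :=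
    fun w _ => (hasDerivAt_eisTerm χ₁ χ₂ p w).differentiableAt.differentiableWithinAt
  have hle (p : ℕ+ × ℕ+) (w : ℂ) (hw : w ∈ {w : ℂ | z.im / 2 < w.im}) :=
    norm_eisTerm_le χ₁ χ₂ p (z := w) (δ := z.im / 2) hw.le
  have h1 := (differentiableOn_tsum_of_summable_norm hsum hdiff hU hle).differentiableAt
    (hU.mem_nhds hzU)
  have h2 := hasSum_deriv_of_summable_norm hsum hdiff hU hle hzU
  refine h1.hasDerivAt.congr_deriv ?_
  rw [← h2.tsum_eq]
  have h3 := h2.summable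
  simp only [fun p => (hasDerivAt_eisTerm χ₁ χ₂ p z).deriv] at h3 ⊢
  rw [tsum_mul_left]
  have h4 : Summable fun p : ℕ+ × ℕ+ => χ₁ ((p.1 : ℕ) : ZMod q₁) *
      (χ₂⁻¹ ((p.2 : ℕ) : ZMod q₂) * ((p.2 : ℕ) *
        exp (2 * Real.pi * I * (p.2 : ℕ) * ((p.1 : ℕ) * z)))) :=
    (summable_mul_left_iff (by simp [Real.pi_ne_zero])).1 h3
  rw [h4.tsum_prod]
  simp only [tsum_mul_left]

theorem summable_char_mul_invSqSum (χ : DirichletCharacter ℂ q₁) {z : ℂ} (hz : 0 < z.im) (w : ℂ) :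
    Summable fun a : ℤ => χ (a : ZMod q₁) * invSqSum (w + a * z) := by
  refine (summable_invSqSum hz w).norm.of_norm_bounded fun a => ?_
  rw [norm_mul]
  exact mul_le_of_le_one_left (norm_nonneg _) (χ.norm_le_one _)

variable [NeZero q₁] [NeZero q₂]

/-- Grouping pairs by n = ab, the weights combine as √(b/a)/√(ab) = 1/a. -/
theorem F_eq_eisSeries (χ₁ : DirichletCharacter ℂ q₁) (χ₂ : DirichletCharacter ℂ q₂) (z : ℍ) :
    F χ₁ χ₂ z = cOne χ₁ χ₂ * (z : ℂ) + cZero χ₁ χ₂ + eisSeries χ₁ χ₂ z := by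
  unfold F eisSeries
  congr 1
  have hs := sigmaAntidiagonalEquivProd.summable_iff.2 (summable_eisTerm χ₁ χ₂ z.im_pos)
  rw [← sigmaAntidiagonalEquivProd.tsum_eq, Summable.tsum_sigma (by exact hs)]
  refine tsum_congr fun n => ?_
  rw [tsum_fintype, lam, Finset.sum_div, Finset.sum_mul, ← Finset.sum_coe_sort]
  refine Finset.sum_congr rfl fun p _ => ?_
  obtain ⟨⟨a, b⟩, hab⟩ := p
  obtain ⟨hn, -⟩ := Nat.mem_divisorsAntidiagonal.1 hab
  have hn' : ((n : ℕ) : ℂ) = a * b := by rw [← hn]; push_cast; rfl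
  have hnr : ((n : ℕ) : ℝ) = a * b := by rw [← hn]; push_cast; rfl
  have ha : 0 < a := Nat.pos_of_ne_zero fun h => n.ne_zero (by rw [← hn]; simp [h])
  have hb : 0 < b := Nat.pos_of_ne_zero fun h => n.ne_zero (by rw [← hn]; simp [h])
  have ha' : (0 : ℝ) < a := by exact_mod_cast ha
  have hb' : (0 : ℝ) < b := by exact_mod_cast hb
  have hsqrt : Real.sqrt ((b : ℝ) / a) / Real.sqrt (a * b) = 1 / a := by
    rw [← Real.sqrt_div (by positivity), show (b : ℝ) / a / (a * b) = (1 / a) ^ 2 by field_simp]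
    exact Real.sqrt_sq (by positivity)
  have hsqrt' : ((Real.sqrt ((b : ℝ) / a) : ℝ) : ℂ) / (Real.sqrt (a * b) : ℝ) = 1 / a := by
    rw [← ofReal_div, hsqrt]; simp
  simp only [eisTerm, sigmaAntidiagonalEquivProd, divisorsAntidiagonalFactors, Equiv.coe_fn_mk,
    PNat.mk_coe]
  rw [hn', hnr, mul_div_assoc, hsqrt', mul_one_div]

/-- A zero Gauss sum would kill the Fourier transform of χ, which is injective, while χ(1) = 1. -/
theorem tau_ne_zero {q : ℕ} [NeZero q] {χ : DirichletCharacter ℂ q} (hχ : χ.IsPrimitive) :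
    tau χ ≠ 0 := by
  intro h
  unfold tau at h
  have h0 : ZMod.dft (χ : ZMod q → ℂ) = 0 := by
    ext k
    rw [hχ.fourierTransform_eq_inv_mul_gaussSum, h, mul_zero, Pi.zero_apply]
  have h1 := (LinearEquiv.map_eq_zero_iff _).1 h0
  have := congrFun h1 1
  simp at this

theorem tau_mul_inv_apply {q : ℕ} [NeZero q] {χ : DirichletCharacter ℂ q} (hχ : χ.IsPrimitive)
    (b : ℕ) : tau χ * χ⁻¹ (b : ZMod q) =
      ∑ j : ZMod q, χ j * exp (2 * Real.pi * I * b * (j.val / q : ℂ)) := by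
  unfold tau
  rw [mul_comm, ← gaussSum_mulShift_of_isPrimitive _ hχ, gaussSum]
  refine Finset.sum_congr rfl fun j _ => ?_
  rw [AddChar.mulShift_apply, ← nsmul_eq_mul, AddChar.map_nsmul_eq_pow, ZMod.stdAddChar_apply,
    ZMod.toCircle_apply, ← exp_nat_mul]
  congr 2; ring

theorem summable_nat_mul_cexp {w : ℂ} (hw : 0 < w.im) :
    Summable fun b : ℕ+ => ((b : ℕ) : ℂ) * exp (2 * Real.pi * I * (b : ℕ) * w) := by
  refine (summable_nat_mul_exp (c := 2 * Real.pi * w.im)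
    (by have := Real.pi_pos; positivity)).of_norm_bounded fun b => ?_
  rw [norm_mul, Complex.norm_natCast, norm_exp_two_pi_mul_I, ← Real.exp_nat_mul]
  refine le_of_eq ?_
  congr 2; ring

/-- The Gauss sum expands χ̄(b) in additive characters, each of which shifts w by j/q. -/
theorem tau_mul_tsum {q : ℕ} [NeZero q] {χ : DirichletCharacter ℂ q} (hχ : χ.IsPrimitive)
    {w : ℂ} (hw : 0 < w.im) :
    tau χ * ∑' b : ℕ+, χ⁻¹ ((b : ℕ) : ZMod q) * ((b : ℕ) * exp (2 * Real.pi * I * (b : ℕ) * w)) =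
      (-4 * Real.pi ^ 2 : ℂ)⁻¹ * ∑ j : ZMod q, χ j * invSqSum (w + (j.val / q : ℝ)) := by
  have hpi : (-4 * Real.pi ^ 2 : ℂ) ≠ 0 := by simp [Real.pi_ne_zero]
  have him (j : ZMod q) : 0 < (w + (j.val / q : ℝ)).im := by simpa using hw
  rw [eq_inv_mul_iff_mul_eq₀ hpi]
  simp only [fun j => invSqSum_eq_tsum_exp (him j), mul_left_comm _ (-4 * Real.pi ^ 2 : ℂ)]
  rw [← Finset.mul_sum]
  congr 1
  rw [← tsum_mul_left]
  simp only [← mul_assoc]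
  simp only [tau_mul_inv_apply hχ, Finset.sum_mul, ← tsum_mul_left]
  rw [← Summable.tsum_finsetSum fun j _ => (summable_nat_mul_cexp (him j)).mul_left _]
  refine tsum_congr fun b => Finset.sum_congr rfl fun j _ => ?_
  push_cast
  rw [mul_add, exp_add]
  ring

theorem invSqSum_add_div_congr {q : ℕ} [NeZero q] (w : ℂ) {m n : ℤ}
    (h : (m : ZMod q) = n) : invSqSum (w + (m / q : ℝ)) = invSqSum (w + (n / q : ℝ)) := by
  rw [ZMod.intCast_eq_intCast_iff_dvd_sub] at h
  obtain ⟨k, hk⟩ := h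
  have hn : n = m + q * k := by linarith
  have hq : ((q : ℕ) : ℂ) ≠ 0 := by exact_mod_cast NeZero.ne q
  rw [hn, ← invSqSum_add_int _ k]
  congr 1
  push_cast
  field_simp
  ring

theorem sum_mul_invSqSum_neg {q : ℕ} [NeZero q] (χ : DirichletCharacter ℂ q) (w : ℂ) :
    ∑ j : ZMod q, χ j * invSqSum (-w + (j.val / q : ℝ)) =
      χ (-1) * ∑ j : ZMod q, χ j * invSqSum (w + (j.val / q : ℝ)) := by
  rw [← Equiv.sum_comp (Equiv.neg (ZMod q)) (fun j => χ j * invSqSum (-w + (j.val / q : ℝ))),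
    Finset.mul_sum]
  refine Finset.sum_congr rfl fun j _ => ?_
  rw [Equiv.neg_apply, neg_eq_neg_one_mul j, map_mul, mul_assoc, ← neg_eq_neg_one_mul]
  congr 2
  have h := invSqSum_add_div_congr (q := q) (-w) (m := (-j).val) (n := -(j.val : ℤ)) (by simp)
  push_cast at h ⊢
  rw [h, ← invSqSum_neg]
  congr 1
  ring

theorem bijective_fin_natCast_zmod (q : ℕ) [NeZero q] :
    Function.Bijective fun i : Fin q => ((i : ℕ) : ZMod q) := by
  rw [Fintype.bijective_iff_injective_and_card]
  refine ⟨fun i j h => ?_, by simp [ZMod.card]⟩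
  simp only [ZMod.natCast_eq_natCast_iff'] at h
  rw [Nat.mod_eq_of_lt i.2, Nat.mod_eq_of_lt j.2] at h
  exact Fin.ext h

/-- Write a = mq₁ + i: the character sees only i, and the sum over m runs through the rows for q₁z.
-/
theorem tsum_char_mul_invSqSum (χ : DirichletCharacter ℂ q₁) {z : ℂ} (hz : 0 < z.im) (w : ℂ) :
    ∑' a : ℤ, χ (a : ZMod q₁) * invSqSum (w + a * z) =
      ∑ i : Fin q₁, χ ((i : ℕ) : ZMod q₁) * eisSum (q₁ * z) ((i / q₁ : ℝ) * (q₁ * z) + w) := by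
  have hq : ((q₁ : ℕ) : ℂ) ≠ 0 := by exact_mod_cast NeZero.ne q₁
  have hs := summable_char_mul_invSqSum χ hz w
  obtain ⟨e, he⟩ : ∃ e : Fin q₁ × ℤ ≃ ℤ, ∀ p, e p = p.2 * q₁ + (p.1 : ℕ) :=
    ⟨(Equiv.prodComm _ _).trans (Int.divModEquiv q₁).symm, fun _ => rfl⟩
  have hs' : Summable fun p : Fin q₁ × ℤ => χ (e p : ZMod q₁) * invSqSum (w + e p * z) :=
    e.summable_iff.2 hs
  rw [← e.tsum_eq, hs'.tsum_prod, tsum_fintype]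
  refine Finset.sum_congr rfl fun i _ => ?_
  rw [eisSum, ← tsum_mul_left]
  refine tsum_congr fun m => ?_
  rw [he]
  congr 2
  · simp
  · push_cast
    field_simp
    ring

/-- The coefficients `χ₁(i) χ₂(j)`. -/
def charCoeff (χ₁ : DirichletCharacter ℂ q₁) (χ₂ : DirichletCharacter ℂ q₂)
    (p : Fin q₁ × ZMod q₂) : ℂ := χ₁ ((p.1 : ℕ) : ZMod q₁) * χ₂ p.2

theorem ne_one_of_isPrimitive {χ : DirichletCharacter ℂ q₁} (hχ : χ.IsPrimitive) (hq : q₁ ≠ 1) :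
    χ ≠ 1 := by
  rintro rfl
  exact hq (hχ.symm.trans (DirichletCharacter.conductor_one))

theorem sum_charCoeff {χ₁ : DirichletCharacter ℂ q₁} (χ₂ : DirichletCharacter ℂ q₂)
    (hχ₁ : χ₁.IsPrimitive) (hq : q₁ ≠ 1) : ∑ p, charCoeff χ₁ χ₂ p = 0 := by
  unfold charCoeff
  rw [Fintype.sum_prod_type]
  simp only
  rw [← Fintype.sum_mul_sum, (bijective_fin_natCast_zmod q₁).sum_comp (fun i => χ₁ i),
    MulChar.sum_eq_zero_of_ne_one (ne_one_of_isPrimitive hχ₁ hq), zero_mul]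

theorem exists_hasDerivAt_eisSeries {χ₁ : DirichletCharacter ℂ q₁} {χ₂ : DirichletCharacter ℂ q₂}
    (hχ₂ : χ₂.IsPrimitive) (hpar : χ₁ (-1) * χ₂ (-1) = 1) (hq : q₁ ≠ 1) :
    ∃ C : ℂ, ∀ z : ℂ, 0 < z.im → HasDerivAt (eisSeries χ₁ χ₂)
      (C * torsionSum (charCoeff χ₁ χ₂) (fun p => p.1 / q₁) (fun p => p.2.val / q₂) (q₁ * z)) z := by
  have ht := tau_ne_zero hχ₂
  refine ⟨2 * Real.pi * I * ((tau χ₂)⁻¹ * ((-4 * Real.pi ^ 2 : ℂ)⁻¹ * 2⁻¹)), fun z hz => ?_⟩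
  refine (hasDerivAt_eisSeries χ₁ χ₂ hz).congr_deriv ?_
  rw [mul_assoc (2 * Real.pi * I : ℂ)]
  congr 1
  -- The sum over a ≥ 1 is half a sum over ℤ: parity makes G even, and G 0 = 0 because q₁ > 1.
  let G : ℤ → ℂ := fun a => χ₁ (a : ZMod q₁) *
    ∑ j : ZMod q₂, χ₂ j * invSqSum (a * z + (j.val / q₂ : ℝ))
  have hinner (a : ℕ+) : χ₁ ((a : ℕ) : ZMod q₁) * ∑' b : ℕ+, χ₂⁻¹ ((b : ℕ) : ZMod q₂) * ((b : ℕ) *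
      exp (2 * Real.pi * I * (b : ℕ) * ((a : ℕ) * z))) =
      ((tau χ₂)⁻¹ * (-4 * Real.pi ^ 2 : ℂ)⁻¹) * G (a : ℕ) := by
    have him : 0 < (((a : ℕ) : ℂ) * z).im := by
      have : (0 : ℝ) < (a : ℕ) := by exact_mod_cast a.pos
      simp [hz]
    have h := tau_mul_tsum hχ₂ him
    rw [← eq_inv_mul_iff_mul_eq₀ ht] at h
    rw [h]
    simp only [G]
    push_cast
    ring
  simp only [hinner]
  rw [tsum_mul_left]
  have hG (a : ℤ) : G a = ∑ j : ZMod q₂, χ₂ j *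
      (χ₁ (a : ZMod q₁) * invSqSum ((j.val / q₂ : ℝ) + a * z)) := by
    simp only [G, Finset.mul_sum]
    refine Finset.sum_congr rfl fun j _ => ?_
    rw [mul_left_comm, add_comm (a * z)]
  have hterm (j : ZMod q₂) := (summable_char_mul_invSqSum χ₁ hz (j.val / q₂ : ℝ)).mul_left (χ₂ j)
  have hGs : Summable G := by
    simp only [funext hG]
    exact summable_sum fun j _ => hterm j
  have hGeven : Function.Even G := fun a => by
    simp only [G]
    push_cast
    rw [neg_eq_neg_one_mul (a : ZMod q₁), map_mul, neg_mul]
    have := sum_mul_invSqSum_neg χ₂ (a * z)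
    push_cast at this
    rw [this]
    linear_combination (χ₁ (a : ZMod q₁) *
      ∑ j : ZMod q₂, χ₂ j * invSqSum (a * z + (j.val / q₂ : ℂ))) * hpar
  have hG0 : G 0 = 0 := by
    have : Fact (1 < q₁) := ⟨by have := NeZero.pos q₁; omega⟩
    simp [G, MulChar.map_zero]
  have h2 := tsum_int_eq_zero_add_two_mul_tsum_pnat hGeven hGs
  have hG1 : ∑' a : ℤ, G a =
      torsionSum (charCoeff χ₁ χ₂) (fun p => p.1 / q₁) (fun p => p.2.val / q₂) (q₁ * z) := by
    simp only [funext hG]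
    rw [Summable.tsum_finsetSum fun j _ => hterm j]
    simp only [tsum_mul_left, tsum_char_mul_invSqSum χ₁ hz, Finset.mul_sum]
    rw [torsionSum, Fintype.sum_prod_type, Finset.sum_comm]
    refine Finset.sum_congr rfl fun i _ => Finset.sum_congr rfl fun j _ => ?_
    rw [charCoeff, mul_left_comm, mul_assoc]
  rw [← hG1, h2, hG0]
  simp
  ring

end

/-! ### Primitives under Möbius maps and parabolic invariance. -/

section

theorem isConst_of_hasDerivAt_zero {f : ℂ → ℂ} (hf : ∀ z : ℂ, 0 < z.im → HasDerivAt f 0 z)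
    {z w : ℂ} (hz : 0 < z.im) (hw : 0 < w.im) : f z = f w := by
  have h := (convex_halfSpace_im_gt 0).norm_image_sub_le_of_norm_hasDerivWithin_le (C := 0)
    (fun x hx => (hf x hx).hasDerivWithinAt) (fun x _ => by simp) hz hw
  rw [zero_mul, norm_le_zero_iff, sub_eq_zero] at h
  exact h.symm

/-- The weight two factor cancels the derivative (cτ + d)⁻² of the Möbius map. -/
theorem hasDerivAt_comp_moebius {ι : Type*} [Fintype ι] {k : ι → ℂ} (hk : ∑ i, k i = 0)
    {x y : ι → ℝ} {C : ℂ} {f : ℂ → ℂ}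
    (hf : ∀ τ : ℂ, 0 < τ.im → HasDerivAt f (C * torsionSum k x y τ) τ)
    {a b c d : ℤ} (h : a * d - b * c = 1) {τ : ℂ} (hτ : 0 < τ.im) :
    HasDerivAt (fun τ => f ((a * τ + b) / (c * τ + d)))
      (C * torsionSum k (fun i => x i * a + y i * c) (fun i => x i * b + y i * d) τ) τ := by
  have hJ := denom_ne_zero_of_det h hτ
  have h1 : HasDerivAt (fun τ : ℂ => (a * τ + b) / (c * τ + d)) (1 / (c * τ + d) ^ 2) τ := by
    have hn : HasDerivAt (fun τ : ℂ => a * τ + b) (a * 1) τ :=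
      ((hasDerivAt_id τ).const_mul (a : ℂ)).add_const _
    have hd : HasDerivAt (fun τ : ℂ => c * τ + d) (c * 1) τ :=
      ((hasDerivAt_id τ).const_mul (c : ℂ)).add_const _
    refine (hn.div hd hJ).congr_deriv ?_
    congr 1
    have hc : (a * d - b * c : ℂ) = 1 := by exact_mod_cast h
    linear_combination hc
  refine ((hf _ (im_moebius_pos h hτ)).comp τ h1).congr_deriv ?_
  rw [torsionSum_modular hk x y h hτ, mul_one_div, mul_left_comm,
    mul_div_cancel_left₀ _ (pow_ne_zero 2 hJ)]

/-- By the mean value inequality high in the half plane, ‖A‖ is at most |h| times an arbitrarily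
small bound for g. -/
theorem comp_add_int_eq_of_tendsto {f g : ℂ → ℂ} (hf : ∀ τ : ℂ, 0 < τ.im → HasDerivAt f (g τ) τ)
    (hg : Tendsto g (comap im atTop) (𝓝 0)) {h : ℤ} {A : ℂ}
    (hA : ∀ τ : ℂ, 0 < τ.im → f (τ + h) - f τ = A) : A = 0 := by
  by_contra hA0
  have hpos : 0 < ‖A‖ / (‖(h : ℂ)‖ + 1) := by positivity
  have hev := (tendsto_zero_iff_norm_tendsto_zero.1 hg).eventually_lt_const hpos
  rw [eventually_comap] at hev
  obtain ⟨Y, hY⟩ := (hev.and (eventually_gt_atTop 0)).exists_forall_of_atTop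
  have hY0 : 0 < Y := (hY Y le_rfl).2
  have key := (convex_halfSpace_im_ge Y).norm_image_sub_le_of_norm_hasDerivWithin_le
    (f := f) (f' := g) (C := ‖A‖ / (‖(h : ℂ)‖ + 1)) (x := Y * I) (y := Y * I + h)
    (fun x hx => (hf x (hY0.trans_le hx)).hasDerivWithinAt)
    (fun x hx => ((hY x.im hx).1 x rfl).le) (show Y ≤ (Y * I : ℂ).im by simp)
    (show Y ≤ (Y * I + h : ℂ).im by simp)
  rw [hA _ (by simpa using hY0), add_sub_cancel_left, div_mul_eq_mul_div,
    le_div_iff₀ (by positivity)] at key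
  nlinarith [norm_pos_iff.2 hA0]

/-- A primitive of a weight two torsion sum is invariant under a parabolic matrix fixing a cusp
at which the torsion sum vanishes. -/
theorem comp_parabolic_eq {ι : Type*} [Fintype ι] {k : ι → ℂ} (hk : ∑ i, k i = 0)
    {x y : ι → ℝ} {C : ℂ} {f : ℂ → ℂ}
    (hf : ∀ τ : ℂ, 0 < τ.im → HasDerivAt f (C * torsionSum k x y τ) τ)
    {a b c d p s t v : ℤ} (h : a * d - b * c = 1) (hσ : p * v - s * t = 1)
    (hp : a * p + b * t = p) (ht : c * p + d * t = t)
    (hinv : ∀ i, k i ≠ 0 → (∃ m : ℤ, x i * a + y i * c = x i + m) ∧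
      ∃ n : ℤ, x i * b + y i * d = y i + n)
    (hcusp : ∀ i, k i ≠ 0 → ∀ m : ℤ, x i * p + y i * t ≠ m) {τ : ℂ} (hτ : 0 < τ.im) :
    f ((a * τ + b) / (c * τ + d)) = f τ := by
  have hconst {z : ℂ} (hz : 0 < z.im) : f ((a * z + b) / (c * z + d)) - f z =
      f ((a * τ + b) / (c * τ + d)) - f τ := by
    refine isConst_of_hasDerivAt_zero
      (f := fun z : ℂ => f ((a * z + b) / (c * z + d)) - f z) (fun z hz => ?_) hz hτ
    refine ((hasDerivAt_comp_moebius hk hf h hz).sub (hf z hz)).congr_deriv ?_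
    rw [torsionSum_congr_int hinv, sub_self]
  have hlim : Tendsto (fun τ => C * torsionSum k (fun i => x i * p + y i * t)
      (fun i => x i * s + y i * v) τ) (comap im atTop) (𝓝 0) := by
    simpa using (tendsto_torsionSum (fun i => x i * s + y i * v) hcusp).const_mul C
  rw [← sub_eq_zero]
  -- With σ = (p s; t v), the conjugate σ⁻¹γσ is translation by this h, its upper right entry, since
  -- γ fixes the column (p, t).
  refine comp_add_int_eq_of_tendsto (h := v * (a * s + b * v) - s * (c * s + d * v))
    (fun τ hτ => hasDerivAt_comp_moebius hk hf hσ hτ) hlim fun z hz => ?_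
  rw [← hconst (im_moebius_pos hσ hz)]
  have hJ := denom_ne_zero_of_det hσ hz
  have hdet : p * (c * s + d * v) - t * (a * s + b * v) = 1 := by
    linear_combination (p * v - s * t) * h + hσ - (c * s + d * v) * hp + (a * s + b * v) * ht
  have e1 : p * (v * (a * s + b * v) - s * (c * s + d * v)) + s = a * s + b * v := by
    linear_combination (a * s + b * v) * hσ - s * hdet
  have e2 : t * (v * (a * s + b * v) - s * (c * s + d * v)) + v = c * s + d * v := by
    linear_combination (c * s + d * v) * hσ - v * hdet
  generalize v * (a * s + b * v) - s * (c * s + d * v) = n at e1 e2 ⊢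
  have hpC : (a * p + b * t : ℂ) = p := by exact_mod_cast hp
  have htC : (c * p + d * t : ℂ) = t := by exact_mod_cast ht
  have e1C : (p * n + s : ℂ) = a * s + b * v := by exact_mod_cast e1
  have e2C : (t * n + v : ℂ) = c * s + d * v := by exact_mod_cast e2
  have n1 : (a * ((p * z + s) / (t * z + v)) + b : ℂ) = (p * (z + n) + s) / (t * z + v) := by
    rw [eq_div_iff hJ, add_mul, mul_assoc, div_mul_cancel₀ _ hJ]
    linear_combination z * hpC - e1C
  have n2 : (c * ((p * z + s) / (t * z + v)) + d : ℂ) = (t * (z + n) + v) / (t * z + v) := by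
    rw [eq_div_iff hJ, add_mul, mul_assoc, div_mul_cancel₀ _ hJ]
    linear_combination z * htC - e2C
  rw [n1, n2, div_div_div_cancel_right₀ hJ]

/-- Integrality would give q₂ ∣ jRu, hence q₂ ∣ Ru, and then q₂ ∣ R as u is prime to Q. With R =
q₂R' and q₁ = QR', R' divides g and so ir, yet is prime to i and r. Thus R' = 1 and R = q₂, which is
excluded. -/
theorem cusp_ne_int {q₁ q₂ Q R g r u i j p t m : ℤ} (hq₁ : q₁ ≠ 0) (hq₂ : 0 < q₂)
    (hR0 : 0 < R) (hQR : q₁ * q₂ = Q * R) (hne : q₂ ≠ R) (hr : IsCoprime r R) (hu : IsCoprime u Q)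
    (hi : IsCoprime i q₁) (hj : IsCoprime j q₂) (hpt : IsCoprime p t) (hp : q₁ * r = p * g)
    (ht : R * u = t * g) : q₂ * i * p + q₁ * j * t ≠ m * (q₁ * q₂) := by
  intro h
  have h1 : q₂ * (i * r) + j * (R * u) = q₂ * (g * m) := by
    refine mul_left_cancel₀ hq₁ ?_
    linear_combination g * h + q₂ * i * hp + q₁ * j * ht
  have h2 : q₂ ∣ R * u := hj.symm.dvd_of_dvd_mul_left
    ((Dvd.intro (g * m - i * r) (by linear_combination -h1)))
  have h3 : q₂ ∣ R := by
    obtain ⟨α, β, hαβ⟩ := hu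
    have : R = α * (R * u) + β * (q₁ * q₂) := by rw [hQR]; linear_combination -R * hαβ
    rw [this]
    exact dvd_add (h2.mul_left _) ((dvd_mul_left _ _).mul_left _)
  obtain ⟨R', rfl⟩ := h3
  have hq₁' : q₁ = Q * R' := mul_right_cancel₀ hq₂.ne' (by linear_combination hQR)
  have h4 : i * r + j * (R' * u) = g * m :=
    mul_left_cancel₀ hq₂.ne' (by linear_combination h1)
  have h5 : R' ∣ g := by
    obtain ⟨α, β, hαβ⟩ := hpt
    exact ⟨α * Q * r + β * q₂ * u, by
      linear_combination -g * hαβ - α * hp - β * ht + α * r * hq₁'⟩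
  have h6 : R' ∣ i * r := by
    rw [show i * r = g * m - j * (R' * u) by linear_combination h4]
    exact dvd_sub (h5.mul_right _) ((dvd_mul_right _ _).mul_left _)
  have hc1 : IsCoprime R' i := (hi.of_isCoprime_of_dvd_right ⟨Q, by rw [hq₁', mul_comm]⟩).symm
  have hc2 : IsCoprime R' r := (hr.of_isCoprime_of_dvd_right (dvd_mul_left _ _)).symm
  have hunit : IsUnit R' := (hc1.mul_right hc2).isUnit_of_dvd' dvd_rfl h6
  have hR' : 0 < R' := pos_of_mul_pos_right hR0 hq₂.le
  rcases Int.isUnit_iff.1 hunit with rfl | rfl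
  · exact hne (mul_one _).symm
  · omega

/-! ### Invariance of the Eisenstein series. -/

variable {q₁ q₂ : ℕ}

theorem eisSeries_add_int (χ₁ : DirichletCharacter ℂ q₁) (χ₂ : DirichletCharacter ℂ q₂) (z : ℂ)
    (n : ℤ) : eisSeries χ₁ χ₂ (z + n) = eisSeries χ₁ χ₂ z := by
  refine tsum_congr fun p => ?_
  unfold eisTerm
  congr 1
  rw [exp_eq_exp_iff_exists_int]
  exact ⟨(p.1 : ℕ) * (p.2 : ℕ) * n, by push_cast; ring⟩

variable [NeZero q₁] [NeZero q₂]

theorem isCoprime_of_apply_ne_zero {q : ℕ} {χ : DirichletCharacter ℂ q} {n : ℕ}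
    (h : χ (n : ZMod q) ≠ 0) : IsCoprime (n : ℤ) (q : ℤ) := by
  rw [Nat.isCoprime_iff_coprime, ← ZMod.isUnit_iff_coprime]
  by_contra hn
  exact h (χ.map_nonunit hn)

theorem eisSeries_parabolic {χ₁ : DirichletCharacter ℂ q₁} {χ₂ : DirichletCharacter ℂ q₂}
    (hχ₁ : χ₁.IsPrimitive) (hχ₂ : χ₂.IsPrimitive) (hpar : χ₁ (-1) * χ₂ (-1) = 1) {Q R : ℕ}
    (hQR : q₁ * q₂ = Q * R) (hq₁ : q₁ ≠ 1) (hq₂ : q₂ ≠ R)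
    {r u : ℤ} (hr : IsCoprime r (R : ℤ)) (hu : IsCoprime u (Q : ℤ)) (k : ℤ)
    {z : ℂ} (hz : 0 < z.im) :
    eisSeries χ₁ χ₂ (((1 + q₁ * q₂ * k * u * r : ℤ) * z + (-(Q * k * r ^ 2) : ℤ)) /
      ((q₁ * q₂ * R * k * u ^ 2 : ℤ) * z + (1 - q₁ * q₂ * k * u * r : ℤ))) =
      eisSeries χ₁ χ₂ z := by
  obtain ⟨C, hC⟩ := exists_hasDerivAt_eisSeries hχ₂ hpar hq₁
  have hq₁0 : (q₁ : ℂ) ≠ 0 := by exact_mod_cast NeZero.ne q₁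
  have hq₁R : (q₁ : ℝ) ≠ 0 := by exact_mod_cast NeZero.ne q₁
  have hq₂R : (q₂ : ℝ) ≠ 0 := by exact_mod_cast NeZero.ne q₂
  have hq₁pos : (0 : ℝ) < q₁ := by exact_mod_cast NeZero.pos q₁
  have hQRZ : (q₁ * q₂ : ℤ) = Q * R := by exact_mod_cast hQR
  have hRpos : 0 < R := Nat.pos_of_ne_zero fun h => by
    simp [h, NeZero.ne] at hQR
  have hf : ∀ τ : ℂ, 0 < τ.im → HasDerivAt (fun τ => eisSeries χ₁ χ₂ (τ / q₁))
      (C / q₁ * torsionSum (charCoeff χ₁ χ₂) (fun p => p.1 / q₁) (fun p => p.2.val / q₂) τ) τ := by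
    intro τ hτ
    have him : 0 < (τ / q₁).im := by
      rw [div_natCast_im]; positivity
    refine ((hC _ him).comp τ ((hasDerivAt_id τ).div_const (q₁ : ℂ))).congr_deriv ?_
    rw [mul_div_cancel₀ _ hq₁0]
    ring
  -- If r = u = 0, coprimality forces R = Q = 1, contradicting q₁ ≠ 1.
  have hgcd : 0 < Int.gcd (q₁ * r) (R * u) := by
    rw [Int.gcd_pos_iff]
    by_contra! h0
    have hr0 : r = 0 := by simpa [NeZero.ne] using h0.1
    have hu0 : u = 0 := by simpa [hRpos.ne'] using h0.2
    rw [hr0, isCoprime_zero_left, Int.ofNat_isUnit, Nat.isUnit_iff] at hr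
    rw [hu0, isCoprime_zero_left, Int.ofNat_isUnit, Nat.isUnit_iff] at hu
    rw [hr, hu] at hQR
    exact hq₁ (Nat.eq_one_of_mul_eq_one_right hQR)
  obtain ⟨p, t, hpt, hp, ht⟩ := Int.exists_gcd_one hgcd
  rw [← Int.isCoprime_iff_gcd_eq_one] at hpt
  have hfix : R * u * p = q₁ * r * t := by linear_combination p * ht - t * hp
  obtain ⟨α, β, hαβ⟩ := id hpt
  -- In the variable τ = q₁z the matrix becomes (a, q₁b; c/q₁, d), with fixed cusp q₁r/(Ru) = p/t in
  -- lowest terms.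
  have key := comp_parabolic_eq (sum_charCoeff χ₂ hχ₁ hq₁) hf
    (a := 1 + q₁ * q₂ * k * u * r) (b := -(q₁ * Q * k * r ^ 2)) (c := q₂ * R * k * u ^ 2)
    (d := 1 - q₁ * q₂ * k * u * r) (p := p) (t := t) (v := α) (s := -β)
    (by linear_combination (-(k ^ 2 * u ^ 2 * r ^ 2 * q₁ * q₂ : ℤ)) * hQRZ)
    (by linear_combination hαβ)
    (by linear_combination (k * u * r * p) * hQRZ + (Q * k * r) * hfix)
    (by linear_combination (q₂ * k * u) * hfix) ?_ ?_ (τ := q₁ * z) (by simpa using mul_pos hq₁pos hz)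
  · simp only [mul_div_cancel_left₀ _ hq₁0] at key
    rw [← key]
    congr 1
    rw [div_div]
    push_cast
    rw [show (q₂ * R * k * u ^ 2 * (q₁ * z) + (1 - q₁ * q₂ * k * u * r) : ℂ) =
      q₁ * q₂ * R * k * u ^ 2 * z + (1 - q₁ * q₂ * k * u * r) by ring,
      show ((1 + q₁ * q₂ * k * u * r) * (q₁ * z) + -(q₁ * Q * k * r ^ 2) : ℂ) =
      ((1 + q₁ * q₂ * k * u * r) * z + -(Q * k * r ^ 2)) * q₁ by ring,
      mul_div_mul_right _ _ hq₁0]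
  · rintro ⟨i, j⟩ -
    refine ⟨⟨i * q₂ * k * u * r + j.val * R * k * u ^ 2, ?_⟩,
      ⟨-(i * Q * k * r ^ 2) - j.val * q₁ * k * u * r, ?_⟩⟩
    · push_cast
      field_simp
      ring
    · push_cast
      field_simp
      ring
  · rintro ⟨i, j⟩ hij m hm
    have hi := isCoprime_of_apply_ne_zero (left_ne_zero_of_mul hij)
    have hj' : χ₂ ((j.val : ℕ) : ZMod q₂) ≠ 0 := by
      rw [ZMod.natCast_zmod_val]
      exact right_ne_zero_of_mul hij
    have hj := isCoprime_of_apply_ne_zero hj'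
    refine cusp_ne_int (m := m) (by exact_mod_cast NeZero.ne q₁) (by exact_mod_cast NeZero.pos q₂)
      (by exact_mod_cast hRpos) hQRZ (by exact_mod_cast hq₂) hr hu hi hj hpt hp ht ?_
    have : (q₂ * i * p + q₁ * j.val * t : ℝ) = m * (q₁ * q₂) := by
      rw [← hm]
      field_simp
    exact_mod_cast this

/-- Matrices in SL₂(ℤ) with equal left columns differ by a translation on the right, and the series
has period 1. -/
theorem eisSeries_moebius {χ₁ : DirichletCharacter ℂ q₁} {χ₂ : DirichletCharacter ℂ q₂}
    (hχ₁ : χ₁.IsPrimitive) (hχ₂ : χ₂.IsPrimitive) (hpar : χ₁ (-1) * χ₂ (-1) = 1) {Q R : ℕ}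
    (hQR : q₁ * q₂ = Q * R) (hq₁ : q₁ ≠ 1) (hq₂ : q₂ ≠ R)
    {r u : ℤ} (hr : IsCoprime r (R : ℤ)) (hu : IsCoprime u (Q : ℤ)) {k a b c d : ℤ}
    (h : a * d - b * c = 1) (ha : a = 1 + q₁ * q₂ * k * u * r)
    (hc : c = q₁ * q₂ * R * k * u ^ 2) {z : ℂ} (hz : 0 < z.im) :
    (∃ n : ℤ, d = 1 + q₁ * q₂ * n) ∧
      eisSeries χ₁ χ₂ ((a * z + b) / (c * z + d)) = eisSeries χ₁ χ₂ z := by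
  have hQRZ : (q₁ * q₂ : ℤ) = Q * R := by exact_mod_cast hQR
  set b₀ : ℤ := -(Q * k * r ^ 2) with hb₀
  set d₀ : ℤ := 1 - q₁ * q₂ * k * u * r with hd₀
  have h₀ : a * d₀ - b₀ * c = 1 := by
    rw [ha, hc, hb₀, hd₀]
    linear_combination (-(k ^ 2 * u ^ 2 * r ^ 2 * q₁ * q₂ : ℤ)) * hQRZ
  obtain ⟨n, hn⟩ : ∃ n, n = d₀ * b - b₀ * d := ⟨_, rfl⟩
  have hb : b = a * n + b₀ := by rw [hn]; linear_combination b₀ * h - b * h₀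
  have hd : d = c * n + d₀ := by rw [hn]; linear_combination d₀ * h - d * h₀
  refine ⟨⟨R * k * u ^ 2 * n - k * u * r, by rw [hd, hc, hd₀]; ring⟩, ?_⟩
  have hz' : 0 < (z + n).im := by simpa using hz
  have key := eisSeries_parabolic hχ₁ hχ₂ hpar hQR hq₁ hq₂ hr hu k hz'
  rw [← ha, ← hc, ← hb₀, ← hd₀, eisSeries_add_int] at key
  rw [← key, hb, hd]
  congr 2 <;> push_cast <;> ring

end

end NewformDedekind

end

/-! ### The vanishing theorem. -/

theorem theorem1p3 (q₁ q₂ N Q R : ℕ) [NeZero q₁] [NeZero q₂]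
    (χ₁ : DirichletCharacter ℂ q₁) (χ₂ : DirichletCharacter ℂ q₂)
    (hχ₁ : χ₁.IsPrimitive) (hχ₂ : χ₂.IsPrimitive)
    (hpar : χ₁ (-1) * χ₂ (-1) = 1)
    (hN : N = q₁ * q₂) (hQR : N = Q * R) (hcop : Nat.Coprime Q R)
    (hq₁ : q₁ ≠ 1) (hq₂ : q₂ ≠ R)
    (r u : ℤ) (hr : IsCoprime r (R : ℤ)) (hu : IsCoprime u (Q : ℤ)) (k : ℤ) :
    NewformDedekind.HasDedekindSumAt χ₁ χ₂
        (1 + (N : ℤ) * k * u * r) ((N : ℤ) * (R : ℤ) * k * u ^ 2) 0 ∧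
      NewformDedekind.HasDedekindSumAt χ₁ χ₂
        (-1 + (N : ℤ) * k * u * r) ((N : ℤ) * (R : ℤ) * k * u ^ 2) 0 := by
  open NewformDedekind in
  subst hN
  have hQRZ : (q₁ * q₂ : ℤ) = Q * R := by exact_mod_cast hQR
  have hchar (ε n : ℤ) : χ₁ ((ε + q₁ * q₂ * n : ℤ) : ZMod q₁) *
      χ₂⁻¹ ((ε + q₁ * q₂ * n : ℤ) : ZMod q₂) = χ₁ (ε : ZMod q₁) * χ₂⁻¹ (ε : ZMod q₂) := by
    congr 2 <;> simp
  have hpar' : χ₁ (-1) * χ₂⁻¹ (-1) = 1 := by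
    have h1 : χ₂⁻¹ (-1) * χ₂ (-1) = 1 := by
      rw [← MulChar.mul_apply, inv_mul_cancel, MulChar.one_apply isUnit_one.neg]
    have h2 : χ₂ (-1) * χ₂ (-1) = 1 := by rw [← map_mul]; simp
    linear_combination χ₂⁻¹ (-1) * χ₂ (-1) * hpar - χ₁ (-1) * χ₂⁻¹ (-1) * h2 + h1
  have hmain (ε : ℤ) (hε : ε * ε = 1) (hψ : χ₁ (ε : ZMod q₁) * χ₂⁻¹ (ε : ZMod q₂) = 1) :
      HasDedekindSumAt χ₁ χ₂ (ε + (q₁ * q₂ : ℕ) * k * u * r)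
        ((q₁ * q₂ : ℕ) * (R : ℤ) * k * u ^ 2) 0 := by
    push_cast
    let γ₀ : SL(2, ℤ) := ⟨!![ε + q₁ * q₂ * k * u * r, -(Q * k * r ^ 2); q₁ * q₂ * R * k * u ^ 2,
      ε - q₁ * q₂ * k * u * r], by
        rw [Matrix.det_fin_two_of]
        linear_combination hε - (k ^ 2 * u ^ 2 * r ^ 2 * q₁ * q₂ : ℤ) * hQRZ⟩
    have hγ₀ : γ₀ 1 0 = q₁ * q₂ * R * k * u ^ 2 := rfl
    refine ⟨⟨γ₀, ?_, rfl, hγ₀⟩, fun γ _ ha hc z => ?_⟩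
    · rw [CongruenceSubgroup.Gamma0_mem, hγ₀, ZMod.intCast_zmod_eq_zero_iff_dvd]
      exact ⟨R * k * u ^ 2, by push_cast; ring⟩
    have hdet := γ.det_coe
    rw [Matrix.det_fin_two] at hdet
    -- Both signs at once: εγ acts on ℍ as γ does, and its left column has the form for sign +1 with
    -- k replaced by εk.
    have hE := eisSeries_moebius hχ₁ hχ₂ hpar hQR hq₁ hq₂ hr hu (k := ε * k)
      (a := ε * γ 0 0) (b := ε * γ 0 1) (c := ε * γ 1 0) (d := ε * γ 1 1)
      (by linear_combination ε * ε * hdet + hε) (by rw [ha]; linear_combination hε)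
      (by rw [hc]; ring) z.im_pos
    obtain ⟨⟨n, hn⟩, hE⟩ := hE
    have hd : γ 1 1 = ε + q₁ * q₂ * (ε * n) := by linear_combination ε * hn - γ 1 1 * hε
    have hεC : (ε : ℂ) ≠ 0 := by
      have : ε ≠ 0 := by rintro rfl; simp at hε
      exact_mod_cast this
    have hz : ((γ • z : ℍ) : ℂ) = (γ 0 0 * z + γ 0 1) / (γ 1 0 * z + γ 1 1) := by
      rw [UpperHalfPlane.specialLinearGroup_apply]
      simp
    have hψγ : psi χ₁ χ₂ γ = 1 := by
      rw [psi, hd, hchar, hψ]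
    have hF : F χ₁ χ₂ (γ • z) = F χ₁ χ₂ z := by
      rw [F_eq_eisSeries, F_eq_eisSeries, cOne, if_neg hq₁, zero_mul, zero_mul, hz, ← hE]
      congr 2
      push_cast
      rw [mul_assoc, mul_assoc, ← mul_add, ← mul_add, mul_div_mul_left _ _ hεC]
    rw [phi, hψγ, hF, one_mul, sub_self, mul_zero]
  refine ⟨hmain 1 (by norm_num) (by simp), ?_⟩
  exact hmain (-1) (by norm_num) (by simpa using hpar')
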